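/- Let $n\ge 1$ and $\Theta=(\theta_1,\ldots,\theta_n)\in\mathbb R^n$, and put $L_\Theta(x_1,\ldots,x_n,y)=\theta_1x_1+\cdots+\theta_nx_n-y$. Let $\omega(\Theta)\in[-\infty,+\infty]$ (respectively $\hat\omega(\Theta)$) be the supremum of the real $\gamma$ such that for arbitrarily large real $t$ (respectively for every sufficiently large real $t$) the system $$0<|x|\le t,\qquad \max_{1\le i\le n}|\theta_ix-y_i|\le t^{-\gamma}$$ has a solution in integers $x,y_1,\ldots,y_n$. Let $\omega(L_\Theta)$ (respectively $\hat\omega(L_\Theta)$) be the supremum of the real $\gamma$ such that for arbitrarily large real $t$ (respectively for every sufficiently large real $t$) the system $$0<\max_{1\le i\le n}|x_i|\le t,\qquad |L_\Theta(x_1,\ldots,x_n,y)|\le t^{-\gamma}$$ has a solution in integers $x_1,\ldots,x_n,y$. If $1,\theta_1,\ldots,\theta_n$ are linearly independent over $\mathbb Q$, then $$\hat\omega(L_\Theta)\le\frac{1+\omega(L_\Theta)}{1+\omega(\Theta)},\qquad \hat\omega(\Theta)\le\frac{1+\omega(L_\Theta)^{-1}}{1+\omega(\Theta)^{-1}}.$$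 Here $(+\infty)^{-1}=0$, $c/(+\infty)=0$ and $(+\infty)/c=+\infty$ for real $c>0$; the first inequality is asserted except when $\omega(\Theta)=\omega(L_\Theta)=+\infty$, where its right-hand side is the indeterminate $\infty/\infty$. The second inequality is asserted in all cases. -/

import Mathlib

open Filter

/-- The linear form `L_Θ(x₁, …, xₙ, y) = θ₁ x₁ + ⋯ + θₙ xₙ - y` at an integer point. -/
def linForm {n : ℕ} (Θ : Fin n → ℝ) (x : Fin n → ℤ) (y : ℤ) : ℝ :=
  (∑ i, Θ i * (x i : ℝ)) - (y : ℝ)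

/-- The system `0 < |x| ≤ t`, `max_i |θ_i x - y_i| ≤ t ^ (-γ)` has an integer solution. -/
def SimSolvable {n : ℕ} (Θ : Fin n → ℝ) (γ t : ℝ) : Prop :=
  ∃ (x : ℤ) (y : Fin n → ℤ), 0 < |(x : ℝ)| ∧ |(x : ℝ)| ≤ t ∧
    ∀ i, |Θ i * (x : ℝ) - (y i : ℝ)| ≤ t ^ (-γ)

/-- The system `0 < max_i |x_i| ≤ t`, `|L_Θ(x, y)| ≤ t ^ (-γ)` has an integer solution. -/
def LinSolvable {n : ℕ} (Θ : Fin n → ℝ) (γ t : ℝ) : Prop :=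
  ∃ (x : Fin n → ℤ) (y : ℤ), (∃ i, 0 < |(x i : ℝ)|) ∧ (∀ i, |(x i : ℝ)| ≤ t) ∧
    |linForm Θ x y| ≤ t ^ (-γ)

/-- The regular Diophantine exponent `ω(Θ)`, with values in `[-∞, +∞]`: the supremum of the real
`γ` such that the simultaneous system is solvable for arbitrarily large `t`. -/
noncomputable def omegaSim {n : ℕ} (Θ : Fin n → ℝ) : EReal :=
  sSup ((fun γ : ℝ => (γ : EReal)) '' {γ : ℝ | ∃ᶠ t : ℝ in atTop, SimSolvable Θ γ t})

/-- The uniform Diophantine exponent `ω̂(Θ)`: the simultaneous system is to be solvable for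
every sufficiently large `t`. -/
noncomputable def omegaHatSim {n : ℕ} (Θ : Fin n → ℝ) : EReal :=
  sSup ((fun γ : ℝ => (γ : EReal)) '' {γ : ℝ | ∀ᶠ t : ℝ in atTop, SimSolvable Θ γ t})

/-- The regular Diophantine exponent `ω(L_Θ)` of the linear form. -/
noncomputable def omegaLin {n : ℕ} (Θ : Fin n → ℝ) : EReal :=
  sSup ((fun γ : ℝ => (γ : EReal)) '' {γ : ℝ | ∃ᶠ t : ℝ in atTop, LinSolvable Θ γ t})

/-- The uniform Diophantine exponent `ω̂(L_Θ)` of the linear form. -/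
noncomputable def omegaHatLin {n : ℕ} (Θ : Fin n → ℝ) : EReal :=
  sSup ((fun γ : ℝ => (γ : EReal)) '' {γ : ℝ | ∀ᶠ t : ℝ in atTop, LinSolvable Θ γ t})

/-! Transference rests on $qL(a,b)=\sum a_i(\theta_iq-p_i)+(\sum a_ip_i-qb)$. When $|qL|\le 1/4$ and
the first sum is at most $1/2$, the integer in brackets vanishes, so $|q||L|\le nXr$ with $|a_i|\le
X$ and errors at most $r$ (`abs_mul_linForm_le`).

First inequality: match a good simultaneous approximation $q=s$ of error $s^{-\gamma}$ with a
uniform solution of the form at height $T=(4s)^{1/\eta}$. Then $|L|\le nTs^{-1-\gamma}\asymp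
T^{1-\eta(1+\gamma)}$, so $\omega(L_\Theta)\ge\eta(1+\gamma)-1$ (`frequently_linSolvable_of_sim`).

Second: match a small value $|L|=1/(4T)$ with a uniform simultaneous solution at height $T$. Then
$|q|\ll T^{1+1/\gamma-\eta}$ with error at most $T^{-\eta}$, which bounds $\omega(\Theta)$ from
below (`mul_one_add_le_of_lin`). -/

open Finset in
/-- If the linear form and the simultaneous approximations are small enough, the two integer points
are orthogonal, which bounds the product `q * L` by the simultaneous errors. -/
lemma abs_mul_linForm_le {n : ℕ} (Θ : Fin n → ℝ) (q : ℤ) (p : Fin n → ℤ) (a : Fin n → ℤ) (b : ℤ)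
    {X r : ℝ} (hX : ∀ i, |(a i : ℝ)| ≤ X) (hr : ∀ i, |Θ i * (q : ℝ) - (p i : ℝ)| ≤ r)
    (hqL : |(q : ℝ)| * |linForm Θ a b| ≤ 1 / 4) (hXr : n * X * r ≤ 1 / 2) :
    |(q : ℝ)| * |linForm Θ a b| ≤ n * X * r := by
  have key : (q : ℝ) * linForm Θ a b = (∑ i, (a i : ℝ) * (Θ i * q - p i)) +
      ((∑ i, a i * p i - q * b : ℤ) : ℝ) := by
    simp only [linForm, mul_sub, Finset.mul_sum, Finset.sum_sub_distrib]
    push_cast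
    have : ∀ i, (q : ℝ) * (Θ i * a i) = a i * (Θ i * q) := fun i => by ring
    simp only [this]
    ring
  have hS : |∑ i, (a i : ℝ) * (Θ i * q - p i)| ≤ n * X * r := by
    refine (abs_sum_le_sum_abs _ _).trans ?_
    have : ∀ i ∈ (univ : Finset (Fin n)), |(a i : ℝ) * (Θ i * q - p i)| ≤ X * r := fun i _ => by
      rw [abs_mul]
      exact mul_le_mul (hX i) (hr i) (abs_nonneg _) ((abs_nonneg _).trans (hX i))
    refine (sum_le_sum this).trans (le_of_eq ?_)
    simp [mul_assoc]
  have hz : (∑ i, a i * p i - q * b : ℤ) = 0 := by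
    rw [← Int.abs_lt_one_iff]
    have h1 : |((∑ i, a i * p i - q * b : ℤ) : ℝ)| < 1 := by
      have : ((∑ i, a i * p i - q * b : ℤ) : ℝ) =
          (q : ℝ) * linForm Θ a b - ∑ i, (a i : ℝ) * (Θ i * q - p i) := by rw [key]; ring
      rw [this]
      refine (abs_sub _ _).trans_lt ?_
      rw [abs_mul]
      linarith
    exact_mod_cast h1
  rw [← abs_mul, key, hz]
  simpa using hS

/-! ### Nonvanishing, elementary exponents and auxiliary asymptotics. -/

lemma linForm_ne_zero {n : ℕ} {Θ : Fin n → ℝ}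
    (hΘ : LinearIndependent ℚ (Fin.cons 1 Θ : Fin (n + 1) → ℝ)) {a : Fin n → ℤ} {b : ℤ}
    (ha : ∃ i, 0 < |(a i : ℝ)|) : linForm Θ a b ≠ 0 := by
  intro h
  obtain ⟨i, hi⟩ := ha
  have := Fintype.linearIndependent_iff.1 hΘ (Fin.cons (-b : ℚ) (fun i => (a i : ℚ))) (by
    rw [Fin.sum_univ_succ]
    simp only [Fin.cons_zero, Fin.cons_succ, Rat.smul_def]
    rw [← h, linForm]
    push_cast
    simp only [mul_comm]
    ring) i.succ
  simp only [Fin.cons_succ, Int.cast_eq_zero] at this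
  simp [this] at hi

lemma mul_sub_ne_zero {n : ℕ} {Θ : Fin n → ℝ}
    (hΘ : LinearIndependent ℚ (Fin.cons 1 Θ : Fin (n + 1) → ℝ)) (i : Fin n) {x y : ℤ}
    (hx : x ≠ 0) : Θ i * (x : ℝ) - (y : ℝ) ≠ 0 := by
  have h := linForm_ne_zero hΘ (a := Pi.single i x) (b := y) ⟨i, by simpa using hx⟩
  convert h using 1
  rw [linForm, Finset.sum_eq_single i]
  · simp
  · intro j _ hj
    simp [hj]
  · simp

lemma SimSolvable.mono {n : ℕ} {Θ : Fin n → ℝ} {γ δ t : ℝ} (ht : 1 ≤ t) (h : δ ≤ γ)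
    (hs : SimSolvable Θ γ t) : SimSolvable Θ δ t := by
  obtain ⟨x, y, h0, h1, h2⟩ := hs
  exact ⟨x, y, h0, h1, fun i =>
    (h2 i).trans (Real.rpow_le_rpow_of_exponent_le ht (by linarith))⟩

lemma LinSolvable.mono {n : ℕ} {Θ : Fin n → ℝ} {γ δ t : ℝ} (ht : 1 ≤ t) (h : δ ≤ γ)
    (hs : LinSolvable Θ γ t) : LinSolvable Θ δ t := by
  obtain ⟨x, y, h0, h1, h2⟩ := hs
  exact ⟨x, y, h0, h1, h2.trans (Real.rpow_le_rpow_of_exponent_le ht (by linarith))⟩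

lemma simSolvable_zero {n : ℕ} (Θ : Fin n → ℝ) {t : ℝ} (ht : 1 ≤ t) : SimSolvable Θ 0 t := by
  refine ⟨1, fun i => ⌊Θ i⌋, by simp, by simpa using ht, fun i => ?_⟩
  simp only [Int.cast_one, mul_one, neg_zero, Real.rpow_zero, Int.self_sub_floor, Int.abs_fract]
  exact (Int.fract_lt_one _).le

/-- Dirichlet's theorem for a single one of the `θ_i`. -/
lemma linSolvable_one {n : ℕ} (hn : 1 ≤ n) (Θ : Fin n → ℝ) {t : ℝ} (ht : 1 ≤ t) :
    LinSolvable Θ 1 t := by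
  let i : Fin n := ⟨0, hn⟩
  obtain ⟨j, k, hk, hkn, h⟩ := Real.exists_int_int_abs_mul_sub_le (Θ i) (Nat.floor_pos.2 ht)
  have hk' : (0 : ℝ) < k := by exact_mod_cast hk
  have hkt : (k : ℝ) ≤ t := by
    have : (k : ℝ) ≤ (⌊t⌋₊ : ℝ) := by exact_mod_cast hkn
    exact this.trans (Nat.floor_le (by linarith))
  refine ⟨Pi.single i k, j, ⟨i, by simpa using hk'.ne'⟩, fun l => ?_, ?_⟩
  · by_cases hl : l = i
    · subst hl
      simpa [abs_of_pos hk'] using hkt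
    · simp only [Pi.single_apply, hl, if_false, Int.cast_zero, abs_zero]
      linarith
  · have : linForm Θ (Pi.single i k) j = k * Θ i - j := by
      rw [linForm, Finset.sum_eq_single i]
      · simp [mul_comm]
      · intro l _ hl
        simp [hl]
      · simp
    rw [this, Real.rpow_neg_one]
    refine h.trans ?_
    rw [one_div]
    exact inv_anti₀ (by linarith) (Nat.lt_floor_add_one t).le

/-- A positive exponent is witnessed by points whose `x` is arbitrarily large. -/
lemma frequently_exists_abs_eq {n : ℕ} (hn : 1 ≤ n) {Θ : Fin n → ℝ}
    (hΘ : LinearIndependent ℚ (Fin.cons 1 Θ : Fin (n + 1) → ℝ)) {γ : ℝ} (hγ : 0 < γ)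
    (h : ∃ᶠ t : ℝ in atTop, SimSolvable Θ γ t) :
    ∃ᶠ s : ℝ in atTop, ∃ (x : ℤ) (y : Fin n → ℤ), |(x : ℝ)| = s ∧
      ∀ i, |Θ i * (x : ℝ) - (y i : ℝ)| ≤ s ^ (-γ) := by
  let i : Fin n := ⟨0, hn⟩
  rw [frequently_atTop]
  intro N
  -- Finitely many nonzero $x$ have $|x|\le N$, and $\theta_i$ is irrational, so their errors stay
  -- away from $0$; an error below $\varepsilon$ forces $|x|>N$.
  obtain ⟨ε, hε, hlow⟩ : ∃ ε : ℝ, 0 < ε ∧ ∀ x : ℤ, x ≠ 0 → |(x : ℝ)| ≤ N → ∀ y : ℤ,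
      ε ≤ |Θ i * (x : ℝ) - (y : ℝ)| := by
    let S : Finset ℤ := (Finset.Icc (-⌈N⌉) ⌈N⌉).erase 0
    let f : ℤ → ℝ := fun x => |Θ i * x - round (Θ i * x)|
    have hf : ∀ x ∈ S, 0 < f x := fun x hx =>
      abs_pos.2 (mul_sub_ne_zero hΘ i (Finset.ne_of_mem_erase hx))
    obtain ⟨ε, hε, h1⟩ : ∃ ε : ℝ, 0 < ε ∧ ∀ x ∈ S, ε ≤ f x := by
      rcases S.eq_empty_or_nonempty with hS | hS
      · exact ⟨1, one_pos, by simp [hS]⟩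
      · obtain ⟨x, hx, hm⟩ := S.exists_min_image f hS
        exact ⟨f x, hf x hx, hm⟩
    refine ⟨ε, hε, fun x hx hxN y => (h1 x ?_).trans (round_le _ _)⟩
    have hxN' : |x| ≤ ⌈N⌉ := by
      have : ((|x| : ℤ) : ℝ) ≤ (⌈N⌉ : ℝ) := by
        push_cast
        exact hxN.trans (Int.le_ceil N)
      exact_mod_cast this
    exact Finset.mem_erase.2 ⟨hx, Finset.mem_Icc.2 (abs_le.1 hxN')⟩
  have hsmall : ∀ᶠ t : ℝ in atTop, t ^ (-γ) < ε :=
    (tendsto_rpow_neg_atTop hγ).eventually_lt_const hε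
  obtain ⟨t, ⟨x, y, h0, h1, h2⟩, ht⟩ := (h.and_eventually hsmall).exists
  refine ⟨|(x : ℝ)|, ?_, x, y, rfl, fun j => (h2 j).trans ?_⟩
  · by_contra! hlt
    have hx : x ≠ 0 := by simpa using h0
    linarith [hlow x hx hlt.le (y i), h2 i]
  · exact Real.rpow_le_rpow_of_nonpos h0 h1 (by linarith)

/-- Any constant times a power is eventually below `ε` times a larger power. -/
lemma eventually_const_mul_rpow_le (C : ℝ) {ε α β : ℝ} (hε : 0 < ε) (h : α < β) :
    ∀ᶠ t : ℝ in atTop, C * t ^ α ≤ ε * t ^ β := by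
  have ht := (tendsto_rpow_neg_atTop (sub_pos.2 h)).const_mul C
  rw [mul_zero] at ht
  filter_upwards [ht.eventually_lt_const hε, eventually_gt_atTop 0] with t h1 h0
  have : t ^ α = t ^ (-(β - α)) * t ^ β := by
    rw [← Real.rpow_add h0]
    ring_nf
  rw [this, ← mul_assoc]
  exact mul_le_mul_of_nonneg_right h1.le (Real.rpow_nonneg h0.le _)

/-! ### From simultaneous approximation to the linear form. -/

lemma frequently_linSolvable_of_sim {n : ℕ} (hn : 1 ≤ n) {Θ : Fin n → ℝ}
    (hΘ : LinearIndependent ℚ (Fin.cons 1 Θ : Fin (n + 1) → ℝ)) {γ η δ : ℝ} (hη : 0 < η)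
    (hsim : ∃ᶠ t : ℝ in atTop, SimSolvable Θ γ t) (hlin : ∀ᶠ t : ℝ in atTop, LinSolvable Θ η t)
    (hδ : δ < η * (1 + γ) - 1) : ∃ᶠ t : ℝ in atTop, LinSolvable Θ δ t := by
  -- If $\gamma\eta\le1$, then $\delta<\eta$ and the uniform hypothesis already suffices.
  rcases le_or_gt (γ * η) 1 with hle | hgt
  · refine Eventually.frequently ?_
    filter_upwards [hlin, eventually_ge_atTop 1] with t h1 ht
    exact h1.mono ht (by nlinarith)
  have hγ : 0 < γ := by
    by_contra! h
    nlinarith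
  -- This height gives $T^{-\eta}=1/(4s)$, exactly the bound $s|L|\le1/4$ needed for orthogonality.
  have hT : Tendsto (fun s : ℝ => (4 * s) ^ η⁻¹) atTop atTop :=
    (tendsto_rpow_atTop (inv_pos.2 hη)).comp (tendsto_id.const_mul_atTop (by norm_num))
  have e1 := eventually_const_mul_rpow_le (n * 4 ^ η⁻¹) (ε := 1 / 2) (by norm_num)
    (show η⁻¹ < γ by rwa [inv_lt_iff_one_lt_mul₀ hη])
  have e2 := eventually_const_mul_rpow_le (n * 4 ^ (η⁻¹ * (1 + δ))) (ε := 1) (by norm_num)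
    (show η⁻¹ * (1 + δ) < 1 + γ by
      rw [inv_mul_lt_iff₀ hη]
      linarith)
  refine hT.frequently ?_
  refine ((frequently_exists_abs_eq hn hΘ hγ hsim).and_eventually
    ((hT.eventually hlin).and (e1.and (e2.and (eventually_ge_atTop 1))))).mono ?_
  rintro s ⟨⟨q, p, rfl, hp⟩, ⟨a, b, ha, haT, hL⟩, h1, h2, hs⟩
  set s := |(q : ℝ)|
  have hs0 : 0 < s := by linarith
  have h4 : 0 < 4 * s := by linarith
  set T := (4 * s) ^ η⁻¹ with hTdef
  have hT0 : 0 < T := Real.rpow_pos_of_pos h4 _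
  have hTη : T ^ (-η) = (4 * s)⁻¹ := by
    rw [hTdef, ← Real.rpow_mul h4.le, mul_neg, inv_mul_cancel₀ hη.ne', Real.rpow_neg_one]
  refine ⟨a, b, ha, haT, ?_⟩
  have hqL : s * |linForm Θ a b| ≤ 1 / 4 := by
    rw [hTη] at hL
    calc s * |linForm Θ a b| ≤ s * (4 * s)⁻¹ := by gcongr
      _ = 1 / 4 := by field_simp
  have hXr : n * T * s ^ (-γ) ≤ 1 / 2 := by
    rw [hTdef, Real.mul_rpow (by norm_num) hs0.le, Real.rpow_neg hs0.le, ← div_eq_mul_inv,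
      div_le_iff₀ (Real.rpow_pos_of_pos hs0 _), ← mul_assoc]
    exact h1
  have hmain := abs_mul_linForm_le Θ q p a b haT hp hqL hXr
  have hT1 : n * T ^ (1 + δ) ≤ s * s ^ γ := by
    rw [hTdef, ← Real.rpow_mul h4.le, Real.mul_rpow (by norm_num) hs0.le, ← mul_assoc]
    refine h2.trans (le_of_eq ?_)
    rw [one_mul, Real.rpow_add hs0, Real.rpow_one]
  rw [Real.rpow_add hT0, Real.rpow_one] at hT1
  rw [Real.rpow_neg hs0.le, ← div_eq_mul_inv, le_div_iff₀ (Real.rpow_pos_of_pos hs0 _)] at hmain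
  rw [Real.rpow_neg hT0.le, ← one_div, le_div_iff₀ (Real.rpow_pos_of_pos hT0 _)]
  have hδ0 : 0 < T ^ δ := Real.rpow_pos_of_pos hT0 _
  have hsγ : 0 < s * s ^ γ := mul_pos hs0 (Real.rpow_pos_of_pos hs0 _)
  refine le_of_mul_le_mul_left ?_ hsγ
  calc s * s ^ γ * (|linForm Θ a b| * T ^ δ)
      = s * |linForm Θ a b| * s ^ γ * T ^ δ := by ring
    _ ≤ n * T * T ^ δ := by gcongr
    _ ≤ s * s ^ γ * 1 := by linarith

/-! ### From the linear form to simultaneous approximation. -/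

/-- A positive exponent of the linear form, parametrised by the inverse of the value of the form. -/
lemma frequently_exists_abs_linForm_eq {n : ℕ} {Θ : Fin n → ℝ}
    (hΘ : LinearIndependent ℚ (Fin.cons 1 Θ : Fin (n + 1) → ℝ)) {γ : ℝ} (hγ : 0 < γ)
    (h : ∃ᶠ t : ℝ in atTop, LinSolvable Θ γ t) :
    ∃ᶠ T : ℝ in atTop, ∃ (a : Fin n → ℤ) (b : ℤ), |linForm Θ a b| = (4 * T)⁻¹ ∧
      ∀ i, |(a i : ℝ)| ≤ (4 * T) ^ γ⁻¹ := by
  rw [frequently_atTop]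
  intro N
  obtain ⟨t, ⟨a, b, ha, hat, hL⟩, ht, ht0⟩ := (h.and_eventually
    (((tendsto_rpow_atTop hγ).eventually_ge_atTop (4 * N)).and (eventually_gt_atTop 0))).exists
  have hpos : 0 < |linForm Θ a b| := abs_pos.2 (linForm_ne_zero hΘ ha)
  have hinv : t ^ γ ≤ |linForm Θ a b|⁻¹ := by
    rw [Real.rpow_neg ht0.le] at hL
    exact (le_inv_comm₀ hpos (Real.rpow_pos_of_pos ht0 _)).1 hL
  refine ⟨|linForm Θ a b|⁻¹ / 4, by linarith, a, b, ?_, fun i => (hat i).trans ?_⟩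
  · rw [mul_div_cancel₀ _ (by norm_num), inv_inv]
  · rw [mul_div_cancel₀ _ (by norm_num)]
    calc t = (t ^ γ) ^ γ⁻¹ := (Real.rpow_rpow_inv ht0.le hγ.ne').symm
      _ ≤ _ := Real.rpow_le_rpow (Real.rpow_nonneg ht0.le _) hinv (inv_pos.2 hγ).le

/-- Common core of the second inequality: large `T` carry simultaneous approximations with an
unusually small `x`. -/
lemma frequently_exists_abs_le {n : ℕ} {Θ : Fin n → ℝ}
    (hΘ : LinearIndependent ℚ (Fin.cons 1 Θ : Fin (n + 1) → ℝ)) {γ η : ℝ} (hγ : 0 < γ)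
    (hγη : 1 < γ * η) (hlin : ∃ᶠ t : ℝ in atTop, LinSolvable Θ γ t)
    (hsim : ∀ᶠ t : ℝ in atTop, SimSolvable Θ η t) :
    ∃ᶠ T : ℝ in atTop, ∃ (x : ℤ) (y : Fin n → ℤ), 0 < |(x : ℝ)| ∧
      |(x : ℝ)| ≤ 4 * n * 4 ^ γ⁻¹ * T ^ (1 + γ⁻¹ - η) ∧
      ∀ i, |Θ i * (x : ℝ) - (y i : ℝ)| ≤ T ^ (-η) := by
  have e1 := eventually_const_mul_rpow_le (n * 4 ^ γ⁻¹) (ε := 1 / 2) (by norm_num)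
    (show γ⁻¹ < η by rwa [inv_lt_iff_one_lt_mul₀ hγ, mul_comm])
  refine ((frequently_exists_abs_linForm_eq hΘ hγ hlin).and_eventually
    (hsim.and (e1.and (eventually_ge_atTop 1)))).mono ?_
  rintro T ⟨⟨a, b, hL, ha⟩, ⟨q, p, hq0, hqT, hp⟩, h1, hT⟩
  have hT0 : 0 < T := by linarith
  refine ⟨q, p, hq0, ?_, hp⟩
  have hqL : |(q : ℝ)| * |linForm Θ a b| ≤ 1 / 4 := by
    rw [hL]
    calc |(q : ℝ)| * (4 * T)⁻¹ ≤ T * (4 * T)⁻¹ := by gcongr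
      _ = 1 / 4 := by field_simp
  have hXr : n * (4 * T) ^ γ⁻¹ * T ^ (-η) ≤ 1 / 2 := by
    rw [Real.mul_rpow (by norm_num) hT0.le, Real.rpow_neg hT0.le, ← div_eq_mul_inv,
      div_le_iff₀ (Real.rpow_pos_of_pos hT0 _), ← mul_assoc]
    exact h1
  have hmain := abs_mul_linForm_le Θ q p a b ha hp hqL hXr
  rw [hL, ← div_eq_mul_inv, div_le_iff₀ (by linarith)] at hmain
  refine hmain.trans (le_of_eq ?_)
  rw [Real.mul_rpow (by norm_num) hT0.le, sub_eq_add_neg, Real.rpow_add hT0, Real.rpow_add hT0,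
    Real.rpow_one]
  ring

/-- Otherwise the exponent $1+\gamma^{-1}-\eta$ is negative and forces a nonzero integer $x$ to
satisfy $|x|<1$. -/
lemma le_one_add_inv_of_lin {n : ℕ} {Θ : Fin n → ℝ}
    (hΘ : LinearIndependent ℚ (Fin.cons 1 Θ : Fin (n + 1) → ℝ)) {γ η : ℝ} (hγ : 0 < γ)
    (hlin : ∃ᶠ t : ℝ in atTop, LinSolvable Θ γ t)
    (hsim : ∀ᶠ t : ℝ in atTop, SimSolvable Θ η t) : η ≤ 1 + γ⁻¹ := by
  by_contra! hlt
  have hγη : 1 < γ * η := by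
    rw [mul_comm, ← inv_lt_iff_one_lt_mul₀ hγ]
    linarith
  have e := eventually_const_mul_rpow_le (4 * n * 4 ^ γ⁻¹) (ε := 1 / 2) (by norm_num)
    (show 1 + γ⁻¹ - η < 0 by linarith)
  obtain ⟨T, ⟨x, y, h0, h1, -⟩, h2⟩ :=
    ((frequently_exists_abs_le hΘ hγ hγη hlin hsim).and_eventually e).exists
  rw [Real.rpow_zero] at h2
  have : (1 : ℝ) ≤ |(x : ℝ)| := by
    have : x ≠ 0 := by simpa using h0
    exact_mod_cast Int.one_le_abs this
  linarith

lemma frequently_simSolvable_of_lin {n : ℕ} {Θ : Fin n → ℝ}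
    (hΘ : LinearIndependent ℚ (Fin.cons 1 Θ : Fin (n + 1) → ℝ)) {γ η w : ℝ} (hγ : 0 < γ)
    (hη : 0 < η) (hw : 0 < w) (hlin : ∃ᶠ t : ℝ in atTop, LinSolvable Θ γ t)
    (hsim : ∀ᶠ t : ℝ in atTop, SimSolvable Θ η t) (h : w * (1 + γ⁻¹ - η) < η) :
    ∃ᶠ t : ℝ in atTop, SimSolvable Θ w t := by
  -- If $\gamma\eta\le1$, the factor $1+\gamma^{-1}-\eta$ is at least $1$, so $w<\eta$.
  rcases le_or_gt (γ * η) 1 with hle | hgt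
  · refine Eventually.frequently ?_
    have : η ≤ γ⁻¹ := by
      rw [← one_div, le_div_iff₀ hγ]
      linarith
    filter_upwards [hsim, eventually_ge_atTop 1] with t h1 ht
    exact h1.mono ht (by nlinarith)
  have e := eventually_const_mul_rpow_le (4 * n * 4 ^ γ⁻¹) (ε := 1) one_pos
    (show 1 + γ⁻¹ - η < η / w by
      rw [lt_div_iff₀ hw]
      linarith)
  -- With $t=T^{\eta/w}$ the error bound $T^{-\eta}$ is $t^{-w}$, and `e` says $|x|\le t$.
  refine (tendsto_rpow_atTop (div_pos hη hw)).frequently ?_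
  refine ((frequently_exists_abs_le hΘ hγ hgt hlin hsim).and_eventually
    (e.and (eventually_gt_atTop 0))).mono ?_
  rintro T ⟨⟨x, y, h0, h1, h2⟩, h3, hT⟩
  refine ⟨x, y, h0, by linarith, fun i => (h2 i).trans (le_of_eq ?_)⟩
  rw [← Real.rpow_mul hT.le]
  congr 1
  field_simp

/-- Real form of the second inequality, with `σ` in the role of `ω(Θ)⁻¹`. -/
lemma mul_one_add_le_of_lin {n : ℕ} {Θ : Fin n → ℝ}
    (hΘ : LinearIndependent ℚ (Fin.cons 1 Θ : Fin (n + 1) → ℝ)) {γ η σ : ℝ} (hγ : 0 < γ)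
    (hη : 0 < η) (hσ : 0 ≤ σ) (hlin : ∃ᶠ t : ℝ in atTop, LinSolvable Θ γ t)
    (hsim : ∀ᶠ t : ℝ in atTop, SimSolvable Θ η t)
    (h : ∀ w : ℝ, (∃ᶠ t : ℝ in atTop, SimSolvable Θ w t) → σ * w ≤ 1) :
    η * (1 + σ) ≤ 1 + γ⁻¹ := by
  have h0 := le_one_add_inv_of_lin hΘ hγ hlin hsim
  by_contra! hlt
  have hσ0 : 0 < σ := hσ.lt_of_ne fun h => by
    rw [← h] at hlt
    linarith
  have hβ : 1 + γ⁻¹ - η < σ * η := by linarith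
  -- The exponent $w=\eta/c$ is attained because $c>1+\gamma^{-1}-\eta$, yet $\sigma w>1$ because
  -- $c<\sigma\eta$.
  obtain ⟨c, hc1, hc2⟩ := exists_between hβ
  have hc : 0 < c := by linarith
  have hw := h (η / c) (frequently_simSolvable_of_lin hΘ hγ hη (div_pos hη hc) hlin hsim (by
    rw [div_mul_eq_mul_div, div_lt_iff₀ hc]
    gcongr))
  rw [← mul_div_assoc, div_le_one hc] at hw
  linarith

/-! ### Passage to suprema and infinite exponents. -/

lemma le_omegaSim {n : ℕ} {Θ : Fin n → ℝ} {γ : ℝ} (h : ∃ᶠ t : ℝ in atTop, SimSolvable Θ γ t) :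
    (γ : EReal) ≤ omegaSim Θ :=
  le_sSup ⟨γ, h, rfl⟩

lemma le_omegaLin {n : ℕ} {Θ : Fin n → ℝ} {γ : ℝ} (h : ∃ᶠ t : ℝ in atTop, LinSolvable Θ γ t) :
    (γ : EReal) ≤ omegaLin Θ :=
  le_sSup ⟨γ, h, rfl⟩

lemma exists_of_lt_omegaSim {n : ℕ} {Θ : Fin n → ℝ} {c : ℝ} (h : (c : EReal) < omegaSim Θ) :
    ∃ γ, c < γ ∧ ∃ᶠ t : ℝ in atTop, SimSolvable Θ γ t := by
  obtain ⟨_, ⟨γ, hγ, rfl⟩, hlt⟩ := lt_sSup_iff.1 h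
  exact ⟨γ, EReal.coe_lt_coe_iff.1 hlt, hγ⟩

lemma exists_of_lt_omegaLin {n : ℕ} {Θ : Fin n → ℝ} {c : ℝ} (h : (c : EReal) < omegaLin Θ) :
    ∃ γ, c < γ ∧ ∃ᶠ t : ℝ in atTop, LinSolvable Θ γ t := by
  obtain ⟨_, ⟨γ, hγ, rfl⟩, hlt⟩ := lt_sSup_iff.1 h
  exact ⟨γ, EReal.coe_lt_coe_iff.1 hlt, hγ⟩

lemma omegaSim_nonneg {n : ℕ} (Θ : Fin n → ℝ) : 0 ≤ omegaSim Θ :=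
  le_omegaSim (γ := 0) ((eventually_ge_atTop 1).mono fun _ => simSolvable_zero Θ).frequently

lemma one_le_omegaLin {n : ℕ} (hn : 1 ≤ n) (Θ : Fin n → ℝ) : 1 ≤ omegaLin Θ :=
  le_omegaLin (γ := 1) ((eventually_ge_atTop 1).mono fun _ => linSolvable_one hn Θ).frequently

lemma exists_eq_coe_of_nonneg {x : EReal} (h0 : 0 ≤ x) (h : x ≠ ⊤) : ∃ r : ℝ, x = r :=
  ⟨x.toReal, (EReal.coe_toReal h fun hb => by simp [hb] at h0).symm⟩

lemma omegaHatLin_le {n : ℕ} (hn : 1 ≤ n) {Θ : Fin n → ℝ}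
    (hΘ : LinearIndependent ℚ (Fin.cons 1 Θ : Fin (n + 1) → ℝ))
    (hne : ¬ (omegaSim Θ = ⊤ ∧ omegaLin Θ = ⊤)) :
    omegaHatLin Θ ≤ (1 + omegaLin Θ) / (1 + omegaSim Θ) := by
  refine sSup_le ?_
  rintro _ ⟨η, hη, rfl⟩
  have hS := omegaSim_nonneg Θ
  have hL := one_le_omegaLin hn Θ
  rcases le_or_gt η 0 with hη0 | hη0
  · refine (EReal.coe_le_coe_iff.2 hη0).trans (EReal.div_nonneg ?_ ?_)
    · exact add_nonneg zero_le_one (zero_le_one.trans hL)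
    · exact add_nonneg zero_le_one hS
  -- Using real $c<\omega(\Theta)$ covers $\omega(\Theta)=+\infty$ as well.
  have key : ∀ l c : ℝ, omegaLin Θ = l → (c : EReal) < omegaSim Θ → η * (1 + c) ≤ 1 + l := by
    intro l c hl hc
    by_contra! hlt
    obtain ⟨γ, hcγ, hγ⟩ := exists_of_lt_omegaSim hc
    obtain ⟨δ, hδ1, hδ2⟩ := exists_between (show l < η * (1 + γ) - 1 by nlinarith)
    have := le_omegaLin (frequently_linSolvable_of_sim hn hΘ hη0 hγ hη hδ2)
    rw [hl, EReal.coe_le_coe_iff] at this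
    linarith
  rcases eq_or_ne (omegaLin Θ) ⊤ with hl | hl
  · rw [hl]
    have hs : omegaSim Θ ≠ ⊤ := fun h => hne ⟨h, hl⟩
    obtain ⟨s, hs'⟩ := exists_eq_coe_of_nonneg hS hs
    rw [hs'] at hS ⊢
    have hs0 : (0 : ℝ) ≤ s := by exact_mod_cast hS
    have h1 : (1 : EReal) + s = ((1 + s : ℝ) : EReal) := rfl
    have h2 : (1 : EReal) + ⊤ = ⊤ := rfl
    rw [h1, h2, EReal.top_div_of_pos_ne_top (by exact_mod_cast (by linarith : (0 : ℝ) < 1 + s))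
      (EReal.coe_ne_top _)]
    exact le_top
  obtain ⟨l, hl'⟩ := exists_eq_coe_of_nonneg (zero_le_one.trans hL) hl
  rcases eq_or_ne (omegaSim Θ) ⊤ with hs | hs
  -- The right-hand side is $0$ here; this $c$ yields $\eta+1+l\le1+l$, excluding $\eta>0$.
  · have := key l ((1 + l) / η) hl' (by rw [hs]; exact EReal.coe_lt_top _)
    rw [mul_add, mul_div_cancel₀ _ hη0.ne'] at this
    linarith
  obtain ⟨s, hs'⟩ := exists_eq_coe_of_nonneg hS hs
  rw [hl', hs']
  rw [hs'] at hS
  have hs0 : (0 : ℝ) ≤ s := by exact_mod_cast hS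
  have h1 : ((1 : EReal) + l) / (1 + s) = ((1 + l) / (1 + s) : ℝ) := rfl
  rw [h1, EReal.coe_le_coe_iff, le_div_iff₀ (by linarith)]
  by_contra! hlt
  have : (1 + l) / η - 1 < s := by
    rw [sub_lt_iff_lt_add', div_lt_iff₀ hη0]
    linarith
  obtain ⟨c, hc1, hc2⟩ := exists_between this
  have := key l c hl' (by rw [hs']; exact EReal.coe_lt_coe_iff.2 hc2)
  rw [sub_lt_iff_lt_add', div_lt_iff₀ hη0] at hc1
  linarith

lemma omegaHatSim_le {n : ℕ} (hn : 1 ≤ n) {Θ : Fin n → ℝ}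
    (hΘ : LinearIndependent ℚ (Fin.cons 1 Θ : Fin (n + 1) → ℝ)) :
    omegaHatSim Θ ≤ (1 + (omegaLin Θ)⁻¹) / (1 + (omegaSim Θ)⁻¹) := by
  refine sSup_le ?_
  rintro _ ⟨η, hη, rfl⟩
  have hS := omegaSim_nonneg Θ
  have hL := one_le_omegaLin hn Θ
  rcases le_or_gt η 0 with hη0 | hη0
  · refine (EReal.coe_le_coe_iff.2 hη0).trans (EReal.div_nonneg ?_ ?_)
    · exact add_nonneg zero_le_one (EReal.inv_nonneg_of_nonneg (zero_le_one.trans hL))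
    · exact add_nonneg zero_le_one (EReal.inv_nonneg_of_nonneg hS)
  -- Hence $\omega(\Theta)>0$, so the default value $0^{-1}=0$ plays no role below.
  have hηS : (η : EReal) ≤ omegaSim Θ := le_omegaSim (Eventually.frequently hη)
  obtain ⟨σ, hσ, hσ0, hσw⟩ : ∃ σ : ℝ, (omegaSim Θ)⁻¹ = σ ∧ 0 ≤ σ ∧
      ∀ w : ℝ, (∃ᶠ t : ℝ in atTop, SimSolvable Θ w t) → σ * w ≤ 1 := by
    rcases eq_or_ne (omegaSim Θ) ⊤ with hs | hs
    · exact ⟨0, by simp [hs], le_rfl, by simp⟩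
    obtain ⟨s, hs'⟩ := exists_eq_coe_of_nonneg hS hs
    rw [hs', EReal.coe_le_coe_iff] at hηS
    have hs0 : 0 < s := by linarith
    refine ⟨s⁻¹, by rw [hs', EReal.coe_inv], (inv_pos.2 hs0).le, fun w hw => ?_⟩
    have := le_omegaSim hw
    rw [hs', EReal.coe_le_coe_iff] at this
    rw [inv_mul_le_iff₀ hs0]
    linarith
  -- Approximating $\omega(L_\Theta)^{-1}$ from above by $\gamma^{-1}$ treats finite and infinite
  -- $\omega(L_\Theta)$ alike.
  obtain ⟨ρ, hρ, hργ⟩ : ∃ ρ : ℝ, (omegaLin Θ)⁻¹ = ρ ∧ ∀ ε > ρ,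
      ∃ γ : ℝ, 0 < γ ∧ γ⁻¹ < ε ∧ ∃ᶠ t : ℝ in atTop, LinSolvable Θ γ t := by
    rcases eq_or_ne (omegaLin Θ) ⊤ with hl | hl
    · refine ⟨0, by simp [hl], fun ε hε => ?_⟩
      obtain ⟨γ, h1, h2⟩ := exists_of_lt_omegaLin (c := ε⁻¹) (Θ := Θ)
        (by rw [hl]; exact EReal.coe_lt_top _)
      exact ⟨γ, (inv_pos.2 hε).trans h1, inv_lt_of_inv_lt₀ hε h1, h2⟩
    obtain ⟨l, hl'⟩ := exists_eq_coe_of_nonneg (zero_le_one.trans hL) hl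
    rw [hl'] at hL
    have hl0 : 0 < l := zero_lt_one.trans_le (by exact_mod_cast hL)
    refine ⟨l⁻¹, by rw [hl', EReal.coe_inv], fun ε hε => ?_⟩
    have hε0 : 0 < ε := (inv_pos.2 hl0).trans hε
    obtain ⟨γ, h1, h2⟩ := exists_of_lt_omegaLin (c := ε⁻¹) (Θ := Θ)
      (by rw [hl', EReal.coe_lt_coe_iff]; exact inv_lt_of_inv_lt₀ hl0 hε)
    exact ⟨γ, (inv_pos.2 hε0).trans h1, inv_lt_of_inv_lt₀ hε0 h1, h2⟩
  rw [hσ, hρ]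
  have h1 : ((1 : EReal) + ρ) / (1 + σ) = ((1 + ρ) / (1 + σ) : ℝ) := rfl
  rw [h1, EReal.coe_le_coe_iff, le_div_iff₀ (by linarith)]
  by_contra! hlt
  obtain ⟨γ, hγ, hγρ, hlin⟩ := hργ (η * (1 + σ) - 1) (by linarith)
  linarith [mul_one_add_le_of_lin hΘ hγ hη0 hσ0 hlin hη hσw]

/-- In the first inequality the only case left out is the one where both `ω(Θ)` and `ω(L_Θ)` are
infinite, in which its right-hand side is the indeterminate `∞ / ∞`. -/
theorem theoremt (n : ℕ) (hn : 1 ≤ n) (Θ : Fin n → ℝ)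
    (hΘ : LinearIndependent ℚ (Fin.cons 1 Θ : Fin (n + 1) → ℝ)) :
    (¬ (omegaSim Θ = ⊤ ∧ omegaLin Θ = ⊤) →
      omegaHatLin Θ ≤ (1 + omegaLin Θ) / (1 + omegaSim Θ)) ∧
    omegaHatSim Θ ≤ (1 + (omegaLin Θ)⁻¹) / (1 + (omegaSim Θ)⁻¹) := by
  exact ⟨omegaHatLin_le hn hΘ, omegaHatSim_le hn hΘ⟩
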